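/- Let $X$ be a real or complex Banach lattice, where a complex Banach lattice is the complexification $X=Z\oplus iZ$ of a real Banach lattice $Z$, with modulus $|x+iy|=\sup_{\theta\in[0,2\pi]}(x\cos\theta+y\sin\theta)\in Z$ and norm $\|x+iy\|=\big\||x+iy|\big\|_Z$; in the real case $|f|=f\vee(-f)$. Let $E\subseteq X$ be a linear subspace (not necessarily closed), let $\gamma\in(0,1]$ and $C>0$. Suppose that $E$ does $\gamma$-Hölder stable phase retrieval with constant $C$, i.e. for all $f,g\in E$, $$\inf_{|\lambda|=1}\|f-\lambda g\|\le C\,\big\||f|-|g|\big\|^{\gamma}\,\big(\|f\|+\|g\|\big)^{1-\gamma},$$ where $\lambda$ ranges over the scalars (real or complex, respectively) of modulus one. Then $E$ does stable phase retrieval with constant $\sqrt2\,(\sqrt8\,C)^{1/\gamma}$, i.e. for all $f,g\in E$, $$\inf_{|\lambda|=1}\|f-\lambda g\|\le \sqrt2\,(\sqrt8\,C)^{1/\gamma}\,\big\||f|-|g|\big\|.$$ -/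

import Mathlib

section Modulus

theorem smul_le_abs_smul_abs {Y : Type*} [AddCommGroup Y] [Lattice Y] [IsOrderedAddMonoid Y]
    [Module ℝ Y] [IsOrderedModule ℝ Y] (a : ℝ) (x : Y) : a • x ≤ |a| • |x| := by
  rcases le_total 0 a with h | h
  · rw [abs_of_nonneg h]
    exact smul_le_smul_of_nonneg_left (le_abs_self x) h
  · rw [abs_of_nonpos h, ← neg_smul_neg]
    exact smul_le_smul_of_nonneg_left (neg_le_abs x) (neg_nonneg.2 h)

variable {X : Type*} [NormedAddCommGroup X] [NormedSpace ℝ X] [CompleteSpace X] [Lattice X]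
  [IsOrderedAddMonoid X] [IsOrderedModule ℝ X] [HasSolidNorm X]

theorem circle_le_circle_add (x y : X) (s t : ℝ) :
    Real.cos s • x + Real.sin s • y ≤
      (Real.cos t • x + Real.sin t • y) + |s - t| • (|x| + |y|) := by
  have key : ∀ (a b : ℝ) (z : X), |a - b| ≤ |s - t| → a • z ≤ b • z + |s - t| • |z| := by
    intro a b z h
    have h1 : (a - b) • z ≤ |s - t| • |z| :=
      (smul_le_abs_smul_abs _ _).trans (smul_le_smul_of_nonneg_right h (abs_nonneg z))
    rw [sub_smul] at h1
    rw [add_comm]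
    exact sub_le_iff_le_add.1 h1
  have h1 := key _ _ x (Real.abs_cos_sub_cos_le s t)
  have h2 := key _ _ y (Real.abs_sin_sub_sin_le s t)
  calc _ ≤ _ := add_le_add h1 h2
    _ = _ := by rw [smul_add]; abel

/-- In a Banach lattice the supremum of `x cos θ + y sin θ` over `θ ∈ [0, 2π]` exists. -/
theorem exists_isLUB_circle (x y : X) :
    ∃ m : X, IsLUB ((fun θ : ℝ => Real.cos θ • x + Real.sin θ • y) ''
      Set.Icc 0 (2 * Real.pi)) m := by
  set u : ℝ → X := fun θ => Real.cos θ • x + Real.sin θ • y with hu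
  set w : X := |x| + |y| with hw
  have hw0 : 0 ≤ w := add_nonneg (abs_nonneg x) (abs_nonneg y)
  have hpi : 0 < 2 * Real.pi := Real.two_pi_pos
  let p : ℕ → ℕ → ℝ := fun n k => 2 * Real.pi * k / (n + 1)
  let ε : ℕ → ℝ := fun n => 2 * Real.pi * (1 / ((n : ℝ) + 1))
  let s : ℕ → X := fun n => (Finset.range (n + 2)).sup' ⟨0, by simp⟩ (fun k => u (p n k))
  have hp : ∀ n k, k ∈ Finset.range (n + 2) → p n k ∈ Set.Icc 0 (2 * Real.pi) := by
    intro n k hk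
    have hk' : (k : ℝ) ≤ n + 1 := by
      have := Finset.mem_range.1 hk
      exact_mod_cast (by omega : k ≤ n + 1)
    refine ⟨by positivity, ?_⟩
    rw [div_le_iff₀ (by positivity)]
    exact mul_le_mul_of_nonneg_left hk' hpi.le
  have hub : ∀ n, ∀ θ ∈ Set.Icc 0 (2 * Real.pi), u θ ≤ s n + ε n • w := by
    intro n θ hθ
    have hn : (0 : ℝ) < n + 1 := by positivity
    set k := ⌊θ * (n + 1) / (2 * Real.pi)⌋₊ with hk
    have h0 : 0 ≤ θ * (n + 1) / (2 * Real.pi) := div_nonneg (mul_nonneg hθ.1 hn.le) hpi.le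
    have h1 : (k : ℝ) ≤ θ * (n + 1) / (2 * Real.pi) := Nat.floor_le h0
    have h2 : θ * (n + 1) / (2 * Real.pi) < k + 1 := Nat.lt_floor_add_one _
    rw [le_div_iff₀ hpi] at h1
    rw [div_lt_iff₀ hpi] at h2
    have hkn : k ∈ Finset.range (n + 2) := by
      rw [Finset.mem_range]
      have h3 : (k : ℝ) * (2 * Real.pi) ≤ (n + 1) * (2 * Real.pi) :=
        h1.trans (by nlinarith [hθ.2])
      have h4 : (k : ℝ) ≤ n + 1 := le_of_mul_le_mul_right h3 hpi
      have h5 : k ≤ n + 1 := by exact_mod_cast h4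
      omega
    have hd : |θ - p n k| ≤ ε n := by
      have e1 : θ - p n k = (θ * (n + 1) - k * (2 * Real.pi)) / (n + 1) := by
        simp only [p]; field_simp
      have e2 : ε n = (2 * Real.pi) / (n + 1) := by simp only [ε]; field_simp
      rw [e1, e2, abs_div, abs_of_pos hn, abs_of_nonneg (by linarith)]
      exact div_le_div_of_nonneg_right (by linarith) hn.le
    calc u θ ≤ u (p n k) + |θ - p n k| • w := circle_le_circle_add x y _ _
      _ ≤ s n + ε n • w := add_le_add (Finset.le_sup' (fun k => u (p n k)) hkn)
          (smul_le_smul_of_nonneg_right hd hw0)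
  have hss : ∀ m n, s m ≤ s n + ε n • w := fun m n =>
    Finset.sup'_le _ _ fun k hk => hub n _ (hp m k hk)
  have hε : Filter.Tendsto ε Filter.atTop (nhds 0) := by
    simpa [ε] using (tendsto_one_div_add_atTop_nhds_zero_nat (𝕜 := ℝ)).const_mul (2 * Real.pi)
  have hεmono : ∀ N n, N ≤ n → ε n ≤ ε N := fun N n h =>
    mul_le_mul_of_nonneg_left (Nat.one_div_le_one_div h) hpi.le
  have hε0 : ∀ n, 0 ≤ ε n := fun n => by positivity
  have hcauchy : CauchySeq s := by
    refine cauchySeq_of_le_tendsto_0 (fun n => ‖ε n • w‖) ?_ ?_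
    · intro n m N hn hm
      rw [dist_eq_norm]
      refine norm_le_norm_of_abs_le_abs ?_
      rw [abs_of_nonneg (smul_nonneg (hε0 N) hw0)]
      have h : ∀ i j, N ≤ j → s i - s j ≤ ε N • w := fun i j hj =>
        (sub_le_iff_le_add'.2 (hss i j)).trans
          (smul_le_smul_of_nonneg_right (hεmono N j hj) hw0)
      refine abs_le'.2 ⟨h n m hm, ?_⟩
      rw [neg_sub]
      exact h m n hn
    · simpa using (hε.smul_const w).norm
  obtain ⟨m, hm⟩ := cauchySeq_tendsto_of_complete hcauchy
  refine ⟨m, ?_, ?_⟩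
  · rintro _ ⟨θ, hθ, rfl⟩
    have ht : Filter.Tendsto (fun n => s n + ε n • w) Filter.atTop (nhds m) := by
      simpa using hm.add (hε.smul_const w)
    exact ge_of_tendsto' ht fun n => hub n θ hθ
  · intro b hb
    exact le_of_tendsto' hm fun n => Finset.sup'_le _ _ fun k hk => hb ⟨_, hp n k hk, rfl⟩

end Modulus

/-- The complexification `X ⊕ iX` of a real vector space; `⟨x, y⟩` stands for `x + iy`. -/
@[ext]
structure Complexification (X : Type*) where
  re : X
  im : X

namespace Complexification

section Algebra

variable {X : Type*} [AddCommGroup X]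

instance : Zero (Complexification X) := ⟨⟨0, 0⟩⟩
instance : Add (Complexification X) := ⟨fun z w => ⟨z.re + w.re, z.im + w.im⟩⟩
instance : Neg (Complexification X) := ⟨fun z => ⟨-z.re, -z.im⟩⟩

@[simp] theorem zero_re : (0 : Complexification X).re = 0 := rfl
@[simp] theorem zero_im : (0 : Complexification X).im = 0 := rfl
@[simp] theorem add_re (z w : Complexification X) : (z + w).re = z.re + w.re := rfl
@[simp] theorem add_im (z w : Complexification X) : (z + w).im = z.im + w.im := rfl
@[simp] theorem neg_re (z : Complexification X) : (-z).re = -z.re := rfl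
@[simp] theorem neg_im (z : Complexification X) : (-z).im = -z.im := rfl

instance : AddCommGroup (Complexification X) where
  add_assoc a b c := by ext <;> simp [add_assoc]
  zero_add a := by ext <;> simp
  add_zero a := by ext <;> simp
  add_comm a b := by ext <;> simp [add_comm]
  neg_add_cancel a := by ext <;> simp
  nsmul := nsmulRec
  zsmul := zsmulRec

variable [Module ℝ X]

/-- `(a + ib)(x + iy) = (ax - by) + i(ay + bx)`. -/
instance : SMul ℂ (Complexification X) :=
  ⟨fun c z => ⟨c.re • z.re - c.im • z.im, c.re • z.im + c.im • z.re⟩⟩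

@[simp] theorem smul_re (c : ℂ) (z : Complexification X) :
    (c • z).re = c.re • z.re - c.im • z.im := rfl
@[simp] theorem smul_im (c : ℂ) (z : Complexification X) :
    (c • z).im = c.re • z.im + c.im • z.re := rfl

instance : Module ℂ (Complexification X) where
  one_smul z := by ext <;> simp
  mul_smul c d z := by ext <;> simp <;> module
  smul_zero c := by ext <;> simp
  smul_add c z w := by ext <;> simp <;> abel
  add_smul c d z := by ext <;> simp <;> module
  zero_smul z := by ext <;> simp

end Algebra

section Norm

theorem norm_le_norm_of_modulus {Y : Type*} [NormedAddCommGroup Y] [Lattice Y]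
    [IsOrderedAddMonoid Y] [HasSolidNorm Y] {a b : Y} (ha : 0 ≤ a) (hab : a ≤ b) : ‖a‖ ≤ ‖b‖ :=
  norm_le_norm_of_abs_le_abs (by rwa [abs_of_nonneg ha, abs_of_nonneg (ha.trans hab)])

variable {X : Type*} [NormedAddCommGroup X] [NormedSpace ℝ X] [CompleteSpace X] [Lattice X]
  [IsOrderedAddMonoid X] [IsOrderedModule ℝ X] [HasSolidNorm X]

/-- The modulus `|x + iy| = sup {x cos θ + y sin θ : θ ∈ [0, 2π]}`, the supremum being taken in
the Banach lattice `X` (it exists by `exists_isLUB_circle`). -/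
noncomputable def modulus (z : Complexification X) : X :=
  Classical.choose (exists_isLUB_circle z.re z.im)

theorem isLUB_modulus (z : Complexification X) :
    IsLUB ((fun θ : ℝ => Real.cos θ • z.re + Real.sin θ • z.im) '' Set.Icc 0 (2 * Real.pi))
      (modulus z) :=
  Classical.choose_spec (exists_isLUB_circle z.re z.im)

theorem le_modulus (z : Complexification X) (θ : ℝ) :
    Real.cos θ • z.re + Real.sin θ • z.im ≤ modulus z := by
  have h := toIcoMod_mem_Ico' Real.two_pi_pos θ
  have h2 := (isLUB_modulus z).1 ⟨_, ⟨h.1, h.2.le⟩, rfl⟩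
  have e : toIcoMod Real.two_pi_pos 0 θ = θ - toIcoDiv Real.two_pi_pos 0 θ * (2 * Real.pi) := by
    rw [toIcoMod, zsmul_eq_mul]
  simpa only [e, Real.cos_sub_int_mul_two_pi, Real.sin_sub_int_mul_two_pi] using h2

theorem modulus_le {z : Complexification X} {b : X}
    (h : ∀ θ : ℝ, Real.cos θ • z.re + Real.sin θ • z.im ≤ b) : modulus z ≤ b :=
  (isLUB_modulus z).2 (by rintro _ ⟨θ, -, rfl⟩; exact h θ)

theorem abs_re_le_modulus (z : Complexification X) : |z.re| ≤ modulus z :=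
  abs_le'.2 ⟨by simpa using le_modulus z 0, by simpa using le_modulus z Real.pi⟩

theorem abs_im_le_modulus (z : Complexification X) : |z.im| ≤ modulus z :=
  abs_le'.2 ⟨by simpa using le_modulus z (Real.pi / 2),
    by simpa using le_modulus z (-(Real.pi / 2))⟩

theorem modulus_nonneg (z : Complexification X) : 0 ≤ modulus z :=
  (abs_nonneg _).trans (abs_re_le_modulus z)

theorem modulus_add_le (z w : Complexification X) : modulus (z + w) ≤ modulus z + modulus w := by
  refine modulus_le fun θ => ?_
  calc _ = (Real.cos θ • z.re + Real.sin θ • z.im) +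
        (Real.cos θ • w.re + Real.sin θ • w.im) := by simp only [add_re, add_im, smul_add]; abel
    _ ≤ _ := add_le_add (le_modulus z θ) (le_modulus w θ)

theorem modulus_smul_le (c : ℂ) (z : Complexification X) : modulus (c • z) ≤ ‖c‖ • modulus z := by
  refine modulus_le fun θ => ?_
  have hre : c.re = ‖c‖ * Real.cos c.arg := (Complex.norm_mul_cos_arg c).symm
  have him : c.im = ‖c‖ * Real.sin c.arg := (Complex.norm_mul_sin_arg c).symm
  calc _ = ‖c‖ • (Real.cos (θ - c.arg) • z.re + Real.sin (θ - c.arg) • z.im) := by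
        rw [smul_re, smul_im, hre, him, Real.cos_sub, Real.sin_sub]; module
    _ ≤ _ := smul_le_smul_of_nonneg_left (le_modulus z _) (norm_nonneg c)

theorem modulus_neg_le (z : Complexification X) : modulus (-z) ≤ modulus z := by
  simpa using modulus_smul_le (-1) z

/-- The norm of the complex Banach lattice: `‖x + iy‖ = ‖ |x + iy| ‖`. -/
noncomputable instance : NormedAddCommGroup (Complexification X) :=
  AddGroupNorm.toNormedAddCommGroup
    { toFun := fun z => ‖modulus z‖
      map_zero' := by
        have h : modulus (0 : Complexification X) ≤ 0 := modulus_le fun θ => by simp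
        rw [le_antisymm h (modulus_nonneg _), norm_zero]
      add_le' := fun z w =>
        (norm_le_norm_of_modulus (modulus_nonneg _) (modulus_add_le z w)).trans (norm_add_le _ _)
      neg' := fun z => by
        refine le_antisymm
          (norm_le_norm_of_modulus (modulus_nonneg _) (modulus_neg_le z))
          (norm_le_norm_of_modulus (modulus_nonneg _) ?_)
        simpa using modulus_neg_le (-z)
      eq_zero_of_map_eq_zero' := fun z h => by
        have h0 : modulus z = 0 := norm_eq_zero.1 h
        have key : ∀ a : X, |a| ≤ modulus z → a = 0 := fun a ha => by
          have := norm_le_norm_of_modulus (abs_nonneg a) ha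
          rw [h0, norm_zero, norm_abs_eq_norm] at this
          exact norm_le_zero_iff.1 this
        exact Complexification.ext (key _ (abs_re_le_modulus z)) (key _ (abs_im_le_modulus z)) }

theorem norm_def (z : Complexification X) : ‖z‖ = ‖modulus z‖ := rfl

noncomputable instance : NormedSpace ℂ (Complexification X) where
  norm_smul_le c z := by
    have h := norm_le_norm_of_modulus (modulus_nonneg _) (modulus_smul_le c z)
    rwa [norm_smul, norm_norm] at h

end Norm

end Complexification

section PhaseRetrieval

variable (𝕜 : Type*) {V X : Type*} [RCLike 𝕜] [NormedAddCommGroup V] [NormedSpace 𝕜 V]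
  [NormedAddCommGroup X]

/-- `E` does `C`-stable phase retrieval: `inf_{|c| = 1} ‖f - c g‖ ≤ C ‖ |f| - |g| ‖` on `E`, where
`m : V → X` is the modulus map of the real or complex Banach lattice `V`, with values in the
underlying real Banach lattice `X`. -/
def DoesStablePhaseRetrieval (m : V → X) (E : Submodule 𝕜 V) (C : ℝ) : Prop :=
  ∀ f ∈ E, ∀ g ∈ E, (⨅ c : {c : 𝕜 // ‖c‖ = 1}, ‖f - (c : 𝕜) • g‖) ≤ C * ‖m f - m g‖

/-- `E` does `γ`-Hölder stable phase retrieval with constant `C`: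
`inf_{|c| = 1} ‖f - c g‖ ≤ C ‖ |f| - |g| ‖ ^ γ (‖f‖ + ‖g‖) ^ (1 - γ)` on `E`, with `m` the
modulus map. -/
def DoesHolderStablePhaseRetrieval (m : V → X) (E : Submodule 𝕜 V) (γ C : ℝ) : Prop :=
  ∀ f ∈ E, ∀ g ∈ E, (⨅ c : {c : 𝕜 // ‖c‖ = 1}, ‖f - (c : 𝕜) • g‖) ≤
    C * ‖m f - m g‖ ^ γ * (‖f‖ + ‖g‖) ^ (1 - γ)

end PhaseRetrieval

/-! Let `D > 0` be the distance from `f` to the unimodular multiples of `g`. The pair is replaced by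
a better conditioned pair in `E`, `F = a f + b g` and `G = b̄ f + ā g`, with `‖F‖ + ‖G‖ ≤ 2`, `‖F -
c G‖ ≥ 1/√2` for all unimodular `c`, and `|a| + |b| ≤ 2 / D`. The Hölder bound for `F, G` then no
longer involves the size of `f, g` and can be solved for `D`.

Two facts carry this. First, `norm_modulus_sub_modulus_conj_comb_le`: passing to `F, G` multiplies
the difference of moduli by at most `|a| + |b|`. For complex numbers this is
`abs_norm_sub_norm_conj_comb_le`. It is transferred to Banach lattices by hand: an inequality
between lattice-linear expressions that holds in `ℝ` follows in `X` from Gordan's alternative, and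
moduli are uniform limits of such expressions. Second, the choice of `a, b`: on the real plane `ℂ`,
`n z = ‖z f - z̄ g‖` is a norm with `n z ≥ D |z|`, and an Auerbach basis of it
(`exists_auerbach_basis`) gives the coefficients. Over `ℝ` it is enough to normalise `f - g` and `f
+ g`. -/

set_option linter.unusedSectionVars false

/-! ### Generated vector sublattices and relative uniform limits. -/

section VectorLattice

variable {Y : Type*} [AddCommGroup Y] [Lattice Y] [IsOrderedAddMonoid Y]

/-- Translations preserve `⊔` and `⊓`, so the induction runs over one summand at a time. -/
theorem add_mem_latticeClosure {s : Set Y} (hs : ∀ a ∈ s, ∀ b ∈ s, a + b ∈ s) {a b : Y}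
    (ha : a ∈ latticeClosure s) (hb : b ∈ latticeClosure s) : a + b ∈ latticeClosure s := by
  have h1 : ∀ a ∈ s, ∀ b ∈ latticeClosure s, a + b ∈ latticeClosure s := by
    intro a ha b hb
    induction hb using latticeClosure_sup_inf_induction with
    | mem b hb => exact subset_latticeClosure (hs a ha b hb)
    | sup b _ c _ h h' => rw [add_sup]; exact isSublattice_latticeClosure.supClosed h h'
    | inf b _ c _ h h' => rw [add_inf]; exact isSublattice_latticeClosure.infClosed h h'
  induction ha using latticeClosure_sup_inf_induction with
  | mem a ha => exact h1 a ha b hb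
  | sup a _ c _ h h' => rw [sup_add]; exact isSublattice_latticeClosure.supClosed h h'
  | inf a _ c _ h h' => rw [inf_add]; exact isSublattice_latticeClosure.infClosed h h'

theorem neg_mem_latticeClosure {s : Set Y} (hs : ∀ a ∈ s, -a ∈ s) {a : Y}
    (ha : a ∈ latticeClosure s) : -a ∈ latticeClosure s := by
  induction ha using latticeClosure_sup_inf_induction with
  | mem a ha => exact subset_latticeClosure (hs a ha)
  | sup a _ c _ h h' => rw [neg_sup]; exact isSublattice_latticeClosure.infClosed h h'
  | inf a _ c _ h h' => rw [neg_inf]; exact isSublattice_latticeClosure.supClosed h h'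

variable [Module ℝ Y] [IsOrderedModule ℝ Y]

theorem smul_mem_latticeClosure_of_pos {s : Set Y} {c : ℝ} (hc : 0 < c) (hs : ∀ a ∈ s, c • a ∈ s)
    {a : Y} (ha : a ∈ latticeClosure s) : c • a ∈ latticeClosure s := by
  induction ha using latticeClosure_sup_inf_induction with
  | mem a ha => exact subset_latticeClosure (hs a ha)
  | sup a _ b _ h h' =>
    have e : c • (a ⊔ b) = c • a ⊔ c • b := map_sup (OrderIso.smulRight hc) a b
    rw [e]; exact isSublattice_latticeClosure.supClosed h h'
  | inf a _ b _ h h' =>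
    have e : c • (a ⊓ b) = c • a ⊓ c • b := map_inf (OrderIso.smulRight hc) a b
    rw [e]; exact isSublattice_latticeClosure.infClosed h h'

/-- The sublattice generated by a subspace of a vector lattice is again a subspace. -/
def Submodule.latticeSpan (V : Submodule ℝ Y) : Submodule ℝ Y where
  carrier := latticeClosure (V : Set Y)
  zero_mem' := subset_latticeClosure V.zero_mem
  add_mem' := add_mem_latticeClosure fun _ ha _ hb => V.add_mem ha hb
  smul_mem' c a ha := by
    rcases lt_trichotomy c 0 with h | rfl | h
    · have h1 := neg_mem_latticeClosure (fun _ h => V.neg_mem h)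
        (smul_mem_latticeClosure_of_pos (neg_pos.2 h) (fun _ h => V.smul_mem _ h) ha)
      simpa using h1
    · simpa using subset_latticeClosure V.zero_mem
    · exact smul_mem_latticeClosure_of_pos h (fun _ h => V.smul_mem _ h) ha

theorem Submodule.supClosed_latticeSpan (V : Submodule ℝ Y) :
    SupClosed (V.latticeSpan : Set Y) := isSublattice_latticeClosure.supClosed

theorem Submodule.le_latticeSpan (V : Submodule ℝ Y) : V ≤ V.latticeSpan := subset_latticeClosure

theorem Submodule.abs_mem_of_supClosed {S : Submodule ℝ Y} (hS : SupClosed (S : Set Y)) {a : Y}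
    (ha : a ∈ S) : |a| ∈ S := hS ha (S.neg_mem ha)

/-- Elements that are uniform limits of elements of `S`, relative to some `w ∈ S`. -/
def RelUniformClosure (S : Submodule ℝ Y) (a : Y) : Prop :=
  ∃ w ∈ S, 0 ≤ w ∧ ∀ ε : ℝ, 0 < ε → ∃ s ∈ S, |a - s| ≤ ε • w

namespace RelUniformClosure

variable {S : Submodule ℝ Y} {a b : Y}

theorem add (ha : RelUniformClosure S a) (hb : RelUniformClosure S b) :
    RelUniformClosure S (a + b) := by
  obtain ⟨w, hw, hw0, h⟩ := ha
  obtain ⟨w', hw', hw0', h'⟩ := hb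
  refine ⟨w + w', S.add_mem hw hw', add_nonneg hw0 hw0', fun ε hε => ?_⟩
  obtain ⟨s, hs, h⟩ := h ε hε
  obtain ⟨s', hs', h'⟩ := h' ε hε
  refine ⟨s + s', S.add_mem hs hs', ?_⟩
  rw [smul_add, add_sub_add_comm]
  exact (abs_add_le _ _).trans (add_le_add h h')

theorem sup (hS : SupClosed (S : Set Y)) (ha : RelUniformClosure S a)
    (hb : RelUniformClosure S b) : RelUniformClosure S (a ⊔ b) := by
  obtain ⟨w, hw, hw0, h⟩ := ha
  obtain ⟨w', hw', hw0', h'⟩ := hb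
  refine ⟨w + w', S.add_mem hw hw', add_nonneg hw0 hw0', fun ε hε => ?_⟩
  obtain ⟨s, hs, h⟩ := h ε hε
  obtain ⟨s', hs', h'⟩ := h' ε hε
  refine ⟨s ⊔ s', hS hs hs', ?_⟩
  have e : a ⊔ b - s ⊔ s' = (a ⊔ b - s ⊔ b) + (b ⊔ s - s' ⊔ s) := by
    rw [sup_comm b s, sup_comm s' s]; abel
  rw [smul_add, e]
  exact (abs_add_le _ _).trans (add_le_add ((abs_sup_sub_sup_le_abs _ _ _).trans h)
    ((abs_sup_sub_sup_le_abs _ _ _).trans h'))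

theorem smul (c : ℝ) (ha : RelUniformClosure S a) : RelUniformClosure S (c • a) := by
  obtain ⟨w, hw, hw0, h⟩ := ha
  refine ⟨|c| • w, S.smul_mem _ hw, smul_nonneg (abs_nonneg c) hw0, fun ε hε => ?_⟩
  obtain ⟨s, hs, h⟩ := h ε hε
  refine ⟨c • s, S.smul_mem c hs, ?_⟩
  have h1 := smul_le_smul_of_nonneg_left h (abs_nonneg c)
  rw [smul_comm] at h1
  rw [← smul_sub]
  refine le_trans (abs_le'.2 ⟨smul_le_abs_smul_abs _ _, ?_⟩) h1
  rw [← neg_smul, ← abs_neg c]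
  exact smul_le_abs_smul_abs _ _

theorem neg (ha : RelUniformClosure S a) : RelUniformClosure S (-a) := by
  simpa using ha.smul (-1)

theorem sub (ha : RelUniformClosure S a) (hb : RelUniformClosure S b) :
    RelUniformClosure S (a - b) := by
  rw [sub_eq_add_neg]; exact ha.add hb.neg

theorem abs (hS : SupClosed (S : Set Y)) (ha : RelUniformClosure S a) :
    RelUniformClosure S |a| := ha.sup hS ha.neg

end RelUniformClosure

/-- `circle_le_circle_add` without a norm. -/
theorem cos_smul_add_sin_smul_le (x y : Y) (s t : ℝ) :
    Real.cos s • x + Real.sin s • y ≤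
      (Real.cos t • x + Real.sin t • y) + |s - t| • (|x| + |y|) := by
  have key : ∀ (a b : ℝ) (z : Y), |a - b| ≤ |s - t| → a • z ≤ b • z + |s - t| • |z| := by
    intro a b z h
    have h1 : (a - b) • z ≤ |s - t| • |z| :=
      (smul_le_abs_smul_abs _ _).trans (smul_le_smul_of_nonneg_right h (abs_nonneg z))
    rw [sub_smul] at h1
    rw [add_comm]
    exact sub_le_iff_le_add.1 h1
  calc _ ≤ _ := add_le_add (key _ _ x (Real.abs_cos_sub_cos_le s t))
        (key _ _ y (Real.abs_sin_sub_sin_le s t))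
    _ = _ := by rw [smul_add]; abel

/-- The circle is Lipschitz in the order sense with constant `|x| + |y|`, so the finite supremum
over an `ε`-net of `[0, 2π]` is within `ε (|x| + |y|)` of `m`. -/
theorem relUniformClosure_of_isLUB_circle {S : Submodule ℝ Y} (hS : SupClosed (S : Set Y))
    {x y m : Y} (hx : x ∈ S) (hy : y ∈ S)
    (hm : IsLUB (Set.range fun θ : ℝ => Real.cos θ • x + Real.sin θ • y) m) :
    RelUniformClosure S m := by
  have hw : |x| + |y| ∈ S :=
    S.add_mem (S.abs_mem_of_supClosed hS hx) (S.abs_mem_of_supClosed hS hy)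
  have hw0 : 0 ≤ |x| + |y| := add_nonneg (abs_nonneg x) (abs_nonneg y)
  refine ⟨|x| + |y|, hw, hw0, fun ε hε => ?_⟩
  obtain ⟨t, -, ht, hcov⟩ :=
    (isCompact_Icc (a := (0 : ℝ)) (b := 2 * Real.pi)).finite_cover_balls hε
  have hclose : ∀ θ : ℝ, ∃ τ ∈ ht.toFinset, Real.cos θ • x + Real.sin θ • y ≤
      (Real.cos τ • x + Real.sin τ • y) + ε • (|x| + |y|) := by
    intro θ
    have h := toIcoMod_mem_Ico' Real.two_pi_pos θ
    have e : toIcoMod Real.two_pi_pos 0 θ = θ - toIcoDiv Real.two_pi_pos 0 θ * (2 * Real.pi) := by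
      rw [toIcoMod, zsmul_eq_mul]
    obtain ⟨τ, hτ, hd⟩ := Set.mem_iUnion₂.1 (hcov ⟨h.1, h.2.le⟩)
    refine ⟨τ, ht.mem_toFinset.2 hτ, ?_⟩
    have h1 := cos_smul_add_sin_smul_le x y (toIcoMod Real.two_pi_pos 0 θ) τ
    rw [Metric.mem_ball, Real.dist_eq] at hd
    have h2 := h1.trans (add_le_add_right (smul_le_smul_of_nonneg_right hd.le hw0) _)
    simpa only [e, Real.cos_sub_int_mul_two_pi, Real.sin_sub_int_mul_two_pi] using h2
  have hne : ht.toFinset.Nonempty := by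
    obtain ⟨τ, hτ, -⟩ := hclose 0
    exact ⟨τ, hτ⟩
  refine ⟨ht.toFinset.sup' hne fun τ => Real.cos τ • x + Real.sin τ • y,
    hS.finsetSup'_mem hne fun τ _ => S.add_mem (S.smul_mem _ hx) (S.smul_mem _ hy), ?_⟩
  refine abs_le'.2 ⟨?_, ?_⟩
  · rw [sub_le_iff_le_add']
    refine hm.2 ?_
    rintro _ ⟨θ, rfl⟩
    obtain ⟨τ, hτ, h⟩ := hclose θ
    exact h.trans (add_le_add_left
      (Finset.le_sup' (fun τ => Real.cos τ • x + Real.sin τ • y) hτ) _)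
  · rw [neg_sub]
    refine (sub_nonpos.2 ?_).trans (smul_nonneg hε.le hw0)
    exact Finset.sup'_le _ _ fun τ _ => hm.1 ⟨τ, rfl⟩

end VectorLattice

/-! ### Transfer of lattice-linear inequalities from `ℝ` to `X`. -/

section Transfer

variable {ι X : Type*} [Fintype ι] [AddCommGroup X] [Module ℝ X]

/-- The linear map sending the coefficients `l` to the pair consisting of the linear functional
with coefficients `l` and its value at the vectors `x`. -/
def linearPair (x : ι → X) : (ι → ℝ) →ₗ[ℝ] ((ι → ℝ) → ℝ) × X where
  toFun l := (fun y => l ⬝ᵥ y, Fintype.linearCombination ℝ x l)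
  map_add' l l' := by ext <;> simp [add_dotProduct]
  map_smul' c l := by ext <;> simp [smul_dotProduct]

@[simp] theorem linearPair_fst (x : ι → X) (l y : ι → ℝ) : (linearPair x l).1 y = l ⬝ᵥ y := rfl

@[simp] theorem linearPair_snd (x : ι → X) (l : ι → ℝ) :
    (linearPair x l).2 = ∑ i, l i • x i := rfl

/-- Gordan's alternative. -/
theorem zero_mem_convexHull_of_forall_exists_dotProduct_nonpos {s : Set (ι → ℝ)} (hs : s.Finite)
    (h : ∀ y, ∃ l ∈ s, l ⬝ᵥ y ≤ 0) : 0 ∈ convexHull ℝ s := by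
  classical
  by_contra h0
  obtain ⟨f, u, hf, hu⟩ :=
    geometric_hahn_banach_point_closed (convex_convexHull ℝ s) (hs.isCompact_convexHull ℝ).isClosed h0
  obtain ⟨l, hl, h⟩ := h fun i => f (Pi.single i 1)
  have e : f l = l ⬝ᵥ fun i => f (Pi.single i 1) := by
    conv_lhs => rw [pi_eq_sum_univ' l]
    simp [dotProduct]
  have := hu l (subset_convexHull ℝ s hl)
  rw [map_zero] at hf
  linarith

variable [Lattice X] [IsOrderedAddMonoid X] [IsOrderedModule ℝ X]

instance {E : Type*} : IsOrderedModule ℝ ((E → ℝ) × X) where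
  smul_le_smul_of_nonneg_left _ hc _ _ h :=
    ⟨fun y => mul_le_mul_of_nonneg_left (h.1 y) hc, smul_le_smul_of_nonneg_left h.2 hc⟩
  smul_le_smul_of_nonneg_right _ ha _ _ h :=
    ⟨fun y => mul_le_mul_of_nonneg_right h (ha.1 y), smul_le_smul_of_nonneg_right h ha.2⟩

/-- If a minimum of finitely many functionals is nowhere positive, some convex combination of their
coefficient vectors vanishes. The infimum in `X` lies below the same combination of the values at
`x`, which is `0`. -/
theorem snd_nonpos_of_mem_infClosure (x : ι → X) {a : ((ι → ℝ) → ℝ) × X}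
    (ha : a ∈ infClosure (LinearMap.range (linearPair x) : Set (((ι → ℝ) → ℝ) × X)))
    (h : a.1 ≤ 0) : a.2 ≤ 0 := by
  classical
  obtain ⟨t, ht, hts, rfl⟩ := ha
  -- One coefficient vector for each element of `t`, which keeps `s` finite.
  obtain ⟨s, -, hs⟩ := Set.exists_subset_bijOn (linearPair x ⁻¹' t) (linearPair x)
  have hst : linearPair x '' s = t := by
    rw [hs.image_eq, Set.image_preimage_eq_inter_range, Set.inter_eq_left]
    exact hts
  have hfin : s.Finite := Set.Finite.of_finite_image (hst ▸ t.finite_toSet) hs.injOn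
  have h0 : 0 ∈ convexHull ℝ s := by
    refine zero_mem_convexHull_of_forall_exists_dotProduct_nonpos hfin fun y => ?_
    have hy : (t.inf' ht id).1 y ≤ 0 := h y
    have e : (t.inf' ht id).1 y = t.inf' ht fun b => b.1 y :=
      Finset.apply_inf'_eq_inf'_comp ht (fun b : ((ι → ℝ) → ℝ) × X => b.1 y) fun _ _ => rfl
    rw [e] at hy
    obtain ⟨b, hb, hby⟩ := (Finset.inf'_le_iff ht).1 hy
    obtain ⟨l, hl, rfl⟩ := hst.symm.subset hb
    exact ⟨l, hl, hby⟩
  have hle : s ⊆ {l | (t.inf' ht id).2 ≤ ∑ i, l i • x i} := fun l hl =>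
    (Finset.inf'_le id (hst.subset ⟨l, hl, rfl⟩) : t.inf' ht id ≤ linearPair x l).2
  have hconv : Convex ℝ {l : ι → ℝ | (t.inf' ht id).2 ≤ ∑ i, l i • x i} := by
    have := (convex_Ici (𝕜 := ℝ) (t.inf' ht id).2).linear_preimage
      (Fintype.linearCombination ℝ x)
    exact this
  simpa using convexHull_min hle hconv h0

/-- Lattice-ordered groups are distributive, so every element is a finite supremum of finite infima,
and the bound can be checked on each infimum. -/
theorem snd_nonpos_of_mem_latticeSpan (x : ι → X) {a : ((ι → ℝ) → ℝ) × X}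
    (ha : a ∈ (LinearMap.range (linearPair x)).latticeSpan) (h : a.1 ≤ 0) : a.2 ≤ 0 := by
  let _ : DistribLattice (((ι → ℝ) → ℝ) × X) := AddCommGroup.toDistribLattice _
  have ha' : a ∈ supClosure (infClosure
      (LinearMap.range (linearPair x) : Set (((ι → ℝ) → ℝ) × X))) := by
    rw [supClosure_infClosure]; exact ha
  obtain ⟨t, ht, hts, rfl⟩ := ha'
  have key : ∀ b ∈ t, b.2 ≤ 0 := fun b hb =>
    snd_nonpos_of_mem_infClosure x (hts hb) (((Finset.le_sup' id hb).1 :).trans h)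
  have e : t.sup' ht id ≤ ((t.sup' ht id).1, 0) :=
    Finset.sup'_le ht id fun b hb => ⟨(Finset.le_sup' id hb).1, key b hb⟩
  exact e.2

end Transfer

/-! ### The modulus inequality for complex numbers. -/

section ScalarInequality

open ComplexConjugate

/-- With `D = |a|² - |b|²`, one has `|F|² - |G|² = D (|z|² - |w|²)`. Inverting the linear system
bounds `|D| (|z| + |w|)` by `(|a| + |b|) (|F| + |G|)`; then `|F| + |G|` is cancelled. -/
theorem abs_norm_sub_norm_conj_comb_le (a b z w : ℂ) :
    |‖a * z + b * w‖ - ‖conj b * z + conj a * w‖| ≤ (‖a‖ + ‖b‖) * |‖z‖ - ‖w‖| := by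
  set F := a * z + b * w with hF
  set G := conj b * z + conj a * w with hG
  set D : ℝ := ‖a‖ ^ 2 - ‖b‖ ^ 2 with hD
  have hsq : (‖F‖ - ‖G‖) * (‖F‖ + ‖G‖) = D * ((‖z‖ - ‖w‖) * (‖z‖ + ‖w‖)) := by
    have e : ‖F‖ ^ 2 - ‖G‖ ^ 2 = D * (‖z‖ ^ 2 - ‖w‖ ^ 2) := by
      simp only [hF, hG, hD, Complex.sq_norm, Complex.normSq_apply, Complex.add_re, Complex.add_im,
        Complex.mul_re, Complex.mul_im, Complex.conj_re, Complex.conj_im]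
      ring
    linear_combination e
  have hDc : (D : ℂ) = conj a * a - conj b * b := by
    rw [hD]; push_cast; rw [Complex.conj_mul', Complex.conj_mul']
  have hz : |D| * ‖z‖ ≤ ‖a‖ * ‖F‖ + ‖b‖ * ‖G‖ := by
    have e : (D : ℂ) * z = conj a * F - b * G := by rw [hDc, hF, hG]; ring
    calc |D| * ‖z‖ = ‖(D : ℂ) * z‖ := by rw [norm_mul, Complex.norm_real, Real.norm_eq_abs]
      _ ≤ _ := by rw [e]; refine (norm_sub_le _ _).trans (by simp)
  have hw : |D| * ‖w‖ ≤ ‖a‖ * ‖G‖ + ‖b‖ * ‖F‖ := by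
    have e : (D : ℂ) * w = a * G - conj b * F := by rw [hDc, hF, hG]; ring
    calc |D| * ‖w‖ = ‖(D : ℂ) * w‖ := by rw [norm_mul, Complex.norm_real, Real.norm_eq_abs]
      _ ≤ _ := by rw [e]; refine (norm_sub_le _ _).trans (by simp)
  rcases (add_nonneg (norm_nonneg F) (norm_nonneg G)).eq_or_lt with h0 | h0
  · have h1 : ‖F‖ = 0 := by linarith [norm_nonneg F, norm_nonneg G]
    have h2 : ‖G‖ = 0 := by linarith [norm_nonneg F, norm_nonneg G]
    rw [h1, h2, sub_zero, abs_zero]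
    positivity
  · refine le_of_mul_le_mul_right ?_ h0
    calc |‖F‖ - ‖G‖| * (‖F‖ + ‖G‖) = |(‖F‖ - ‖G‖) * (‖F‖ + ‖G‖)| := by
          rw [abs_mul, abs_of_pos h0]
      _ = (|D| * ‖z‖ + |D| * ‖w‖) * |‖z‖ - ‖w‖| := by
          rw [hsq, abs_mul, abs_mul, abs_of_nonneg (by positivity : 0 ≤ ‖z‖ + ‖w‖)]; ring
      _ ≤ ((‖a‖ + ‖b‖) * (‖F‖ + ‖G‖)) * |‖z‖ - ‖w‖| :=
          mul_le_mul_of_nonneg_right (by linarith) (abs_nonneg _)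
      _ = _ := by ring

theorem isLUB_cos_mul_re_add_sin_mul_im (z : ℂ) :
    IsLUB (Set.range fun θ : ℝ => Real.cos θ * z.re + Real.sin θ * z.im) ‖z‖ := by
  have e : ∀ θ : ℝ, Real.cos θ * z.re + Real.sin θ * z.im = ‖z‖ * Real.cos (θ - z.arg) := by
    intro θ
    rw [Real.cos_sub]
    linear_combination (-Real.cos θ) * Complex.norm_mul_cos_arg z -
      Real.sin θ * Complex.norm_mul_sin_arg z
  refine ⟨?_, fun b hb => ?_⟩
  · rintro _ ⟨θ, rfl⟩
    simp only [e]
    exact mul_le_of_le_one_right (norm_nonneg z) (Real.cos_le_one _)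
  · have := hb ⟨z.arg, rfl⟩
    simpa [e] using this

end ScalarInequality

/-! ### The modulus inequality in a complex Banach lattice. -/

namespace Complexification

section TwoVectors

open ComplexConjugate

variable {X : Type*} [NormedAddCommGroup X] [NormedSpace ℝ X] [CompleteSpace X] [Lattice X]
  [IsOrderedAddMonoid X] [IsOrderedModule ℝ X] [HasSolidNorm X]

/-- The real and imaginary parts of a pair of elements of the complexification. -/
def parts (f g : Complexification X) : Fin 4 → X := ![f.re, f.im, g.re, g.im]

/-- The modulus of `a f + b g`, paired with the same expression in complex numbers. -/
noncomputable def modulusPair (f g : Complexification X) (a b : ℂ) : ((Fin 4 → ℝ) → ℝ) × X :=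
  (fun y => ‖a * ⟨y 0, y 1⟩ + b * ⟨y 2, y 3⟩‖, modulus (a • f + b • g))

/-- Suprema in the product are componentwise. The two vectors hold the coordinates of the real and
imaginary parts of `a f + b g` in terms of `parts f g`. -/
theorem isLUB_modulusPair (f g : Complexification X) (a b : ℂ) :
    IsLUB (Set.range fun θ : ℝ =>
      Real.cos θ • linearPair (parts f g) ![a.re, -a.im, b.re, -b.im] +
        Real.sin θ • linearPair (parts f g) ![a.im, a.re, b.im, b.re]) (modulusPair f g a b) := by
  have h1 : ∀ (θ : ℝ) (y : Fin 4 → ℝ), (Real.cos θ • linearPair (parts f g)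
      ![a.re, -a.im, b.re, -b.im] + Real.sin θ • linearPair (parts f g)
      ![a.im, a.re, b.im, b.re]).1 y = Real.cos θ * (a * ⟨y 0, y 1⟩ + b * ⟨y 2, y 3⟩ : ℂ).re +
        Real.sin θ * (a * ⟨y 0, y 1⟩ + b * ⟨y 2, y 3⟩ : ℂ).im := by
    intro θ y
    simp [dotProduct, Fin.sum_univ_four]
    ring
  have h2 : ∀ θ : ℝ, (Real.cos θ • linearPair (parts f g)
      ![a.re, -a.im, b.re, -b.im] + Real.sin θ • linearPair (parts f g)
      ![a.im, a.re, b.im, b.re]).2 = Real.cos θ • (a • f + b • g).re +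
        Real.sin θ • (a • f + b • g).im := by
    intro θ
    simp [Fin.sum_univ_four, parts]
    module
  refine ⟨?_, fun c hc => ⟨fun y => ?_, ?_⟩⟩
  · rintro _ ⟨θ, rfl⟩
    refine ⟨fun y => ?_, ?_⟩
    · exact (h1 θ y).trans_le ((isLUB_cos_mul_re_add_sin_mul_im _).1 ⟨θ, rfl⟩)
    · exact (h2 θ).trans_le (le_modulus _ θ)
  · refine (isLUB_cos_mul_re_add_sin_mul_im _).2 ?_
    rintro _ ⟨θ, rfl⟩
    exact (h1 θ y).symm.trans_le ((hc ⟨θ, rfl⟩).1 y)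
  · exact modulus_le fun θ => (h2 θ).symm.trans_le (hc ⟨θ, rfl⟩).2

theorem relUniformClosure_modulusPair (f g : Complexification X) (a b : ℂ) :
    RelUniformClosure (LinearMap.range (linearPair (parts f g))).latticeSpan
      (modulusPair f g a b) :=
  relUniformClosure_of_isLUB_circle (Submodule.supClosed_latticeSpan _)
    (Submodule.le_latticeSpan _ ⟨_, rfl⟩) (Submodule.le_latticeSpan _ ⟨_, rfl⟩)
    (isLUB_modulusPair f g a b)

/-- The lower approximant `s - ε w` lies in the span and below `a`, so its second component is
nonpositive; `a` exceeds it by at most `2 ε w`, and `ε` tends to `0`. -/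
theorem snd_nonpos_of_relUniformClosure {ι : Type*} [Fintype ι] (x : ι → X)
    {a : ((ι → ℝ) → ℝ) × X}
    (ha : RelUniformClosure (LinearMap.range (linearPair x)).latticeSpan a) (h : a.1 ≤ 0) :
    a.2 ≤ 0 := by
  obtain ⟨w, hw, hw0, ha⟩ := ha
  have key : ∀ ε : ℝ, 0 < ε → a.2 ≤ (2 * ε) • w.2 := by
    intro ε hε
    obtain ⟨s, hs, hle⟩ := ha ε hε
    have h1 : s - ε • w ≤ a := by
      rw [sub_le_iff_le_add, ← sub_le_iff_le_add']
      exact (neg_sub a s ▸ neg_le_abs (a - s)).trans hle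
    have h2 : a ≤ s + ε • w := sub_le_iff_le_add'.1 ((le_abs_self _).trans hle)
    have h3 : (s - ε • w).2 ≤ 0 := snd_nonpos_of_mem_latticeSpan x
      (Submodule.sub_mem _ hs (Submodule.smul_mem _ _ hw)) (h1.1.trans h)
    calc a.2 ≤ (s + ε • w).2 := h2.2
      _ = (s - ε • w).2 + (2 * ε) • w.2 := by
          simp only [Prod.snd_add, Prod.snd_sub, Prod.smul_snd]; module
      _ ≤ _ := add_le_of_nonpos_left h3
  have hlim : Filter.Tendsto (fun ε : ℝ => (2 * ε) • w.2) (nhdsWithin 0 (Set.Ioi 0)) (nhds 0) := by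
    have : Filter.Tendsto (fun ε : ℝ => (2 * ε) • w.2) (nhds 0) (nhds ((2 * 0 : ℝ) • w.2)) :=
      Continuous.tendsto (by fun_prop) 0
    simpa using this.mono_left nhdsWithin_le_nhds
  exact ge_of_tendsto hlim (Filter.eventually_of_mem self_mem_nhdsWithin key)

/-- In a complex Banach lattice,
`||a f + b g| - |b̄ f + ā g|| ≤ (|a| + |b|) ||f| - |g||`. -/
theorem abs_modulus_sub_modulus_conj_comb_le (f g : Complexification X) (a b : ℂ) :
    |modulus (a • f + b • g) - modulus (conj b • f + conj a • g)| ≤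
      (‖a‖ + ‖b‖) • |modulus f - modulus g| := by
  set S := (LinearMap.range (linearPair (parts f g))).latticeSpan
  have hS : SupClosed (S : Set (((Fin 4 → ℝ) → ℝ) × X)) := Submodule.supClosed_latticeSpan _
  have hM := relUniformClosure_modulusPair f g
  have h := snd_nonpos_of_relUniformClosure (parts f g)
    -- The coefficients `(1, 0)` and `(0, 1)` represent `|f|` and `|g|`.
    ((((hM a b).sub (hM (conj b) (conj a))).abs hS).sub
      ((((hM 1 0).sub (hM 0 1)).abs hS).smul (‖a‖ + ‖b‖)))
    (fun y => by
      have := abs_norm_sub_norm_conj_comb_le a b ⟨y 0, y 1⟩ ⟨y 2, y 3⟩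
      have e : ‖(1 : ℂ) * ⟨y 0, y 1⟩ + 0 * ⟨y 2, y 3⟩‖ = ‖(⟨y 0, y 1⟩ : ℂ)‖ := by simp
      have e' : ‖(0 : ℂ) * ⟨y 0, y 1⟩ + 1 * ⟨y 2, y 3⟩‖ = ‖(⟨y 2, y 3⟩ : ℂ)‖ := by simp
      refine sub_nonpos.2 ?_
      rw [← e, ← e'] at this
      exact this)
  have h' : |modulus (a • f + b • g) - modulus (conj b • f + conj a • g)| -
      (‖a‖ + ‖b‖) • |modulus ((1 : ℂ) • f + (0 : ℂ) • g) -
        modulus ((0 : ℂ) • f + (1 : ℂ) • g)| ≤ 0 := h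
  simpa using h'

theorem norm_modulus_sub_modulus_conj_comb_le (f g : Complexification X) (a b : ℂ) :
    ‖modulus (a • f + b • g) - modulus (conj b • f + conj a • g)‖ ≤
      (‖a‖ + ‖b‖) * ‖modulus f - modulus g‖ := by
  have h := norm_le_norm_of_modulus (abs_nonneg _) (abs_modulus_sub_modulus_conj_comb_le f g a b)
  rwa [norm_smul, norm_abs_eq_norm, norm_abs_eq_norm, Real.norm_of_nonneg (by positivity)] at h

/-- The canonical embedding of a real Banach lattice in its complexification preserves moduli. -/
theorem modulus_real (x : X) : modulus (⟨x, 0⟩ : Complexification X) = |x| := by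
  refine le_antisymm (modulus_le fun θ => ?_) (abs_re_le_modulus ⟨x, 0⟩)
  simpa using (smul_le_abs_smul_abs (Real.cos θ) x).trans
    (smul_le_smul_of_nonneg_right (Real.abs_cos_le_one θ) (abs_nonneg x))

theorem _root_.norm_abs_sub_abs_comb_le (f g : X) (a b : ℝ) :
    ‖|a • f + b • g| - |b • f + a • g|‖ ≤ (|a| + |b|) * ‖|f| - |g|‖ := by
  have e : ∀ c d : ℝ, modulus ((c : ℂ) • (⟨f, 0⟩ : Complexification X) + (d : ℂ) • ⟨g, 0⟩) =
      |c • f + d • g| := by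
    intro c d
    rw [← modulus_real]
    congr 1
    ext <;> simp [-Complex.coe_smul]
  simpa [-Complex.coe_smul, e, modulus_real] using norm_modulus_sub_modulus_conj_comb_le ⟨f, 0⟩ ⟨g, 0⟩ (a : ℂ) b

end TwoVectors

end Complexification

/-! ### Auerbach bases of a normed real plane. -/

section Auerbach

open ComplexConjugate

/-- An Auerbach basis of `ℂ`, as a real plane, for the norm `n`. -/
theorem exists_auerbach_basis (n : Seminorm ℝ ℂ) (hn : Continuous n) {D : ℝ} (hD : 0 < D)
    (hDn : ∀ z, D * ‖z‖ ≤ n z) :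
    ∃ z w : ℂ, n z ≤ 1 ∧ n w ≤ 1 ∧
      ∀ a b : ℝ, |a| ≤ n (a * z + b * w) ∧ |b| ≤ n (a * z + b * w) := by
  set S : Set ℂ := {z | n z ≤ 1} with hS
  have hcomp : IsCompact S := by
    refine (isCompact_closedBall (0 : ℂ) (1 / D)).of_isClosed_subset
      (isClosed_le hn continuous_const) fun z hz => ?_
    rw [mem_closedBall_zero_iff, le_div_iff₀ hD, mul_comm]
    exact (hDn z).trans hz
  have hne : S.Nonempty := ⟨0, by simp [hS]⟩
  -- The basis spans a parallelogram of maximal area among pairs in the unit ball.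
  obtain ⟨⟨z, w⟩, ⟨hz, hw⟩, hmax⟩ := (hcomp.prod hcomp).exists_isMaxOn (hne.prod hne)
    (f := fun p : ℂ × ℂ => p.1.re * p.2.im - p.1.im * p.2.re) (by fun_prop)
  set M : ℝ := z.re * w.im - z.im * w.re with hM
  have hle : ∀ x ∈ S, ∀ y ∈ S, x.re * y.im - x.im * y.re ≤ M := fun x hx y hy =>
    hmax (Set.mk_mem_prod hx hy)
  have hMpos : 0 < M := by
    -- Multiples of `1` and `I` small enough for the unit ball have determinant `t ^ 2 > 0`.
    set t : ℝ := 1 / (n 1 + n Complex.I + 1) with ht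
    have h1 := apply_nonneg n 1
    have h2 := apply_nonneg n Complex.I
    have ht0 : 0 < t := by positivity
    have h3 : ∀ x : ℂ, n x ≤ n 1 + n Complex.I + 1 → t • x ∈ S := by
      intro x hx
      change n (t • x) ≤ 1
      rw [map_smul_eq_mul, Real.norm_of_nonneg ht0.le, ht, one_div, inv_mul_eq_div,
        div_le_one (by positivity)]
      exact hx
    have h4 := hle _ (h3 1 (by linarith)) _ (h3 Complex.I (by linarith))
    simp only [Complex.smul_re, Complex.smul_im, Complex.one_re, Complex.one_im, Complex.I_re,
      Complex.I_im, smul_eq_mul] at h4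
    nlinarith
  have hscale : ∀ x : ℂ, ∃ y ∈ S, x = n x • y := by
    intro x
    rcases (apply_nonneg n x).eq_or_lt with h | h
    · refine ⟨0, by simp [hS], ?_⟩
      have h1 := hDn x
      rw [← h] at h1
      have h2 : ‖x‖ ≤ 0 := nonpos_of_mul_nonpos_right h1 hD
      simpa using h2
    · refine ⟨(n x)⁻¹ • x, ?_, by rw [smul_smul, mul_inv_cancel₀ h.ne', one_smul]⟩
      change n _ ≤ 1
      rw [map_smul_eq_mul, Real.norm_of_nonneg (inv_nonneg.2 h.le), inv_mul_cancel₀ h.ne']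
  have hcoef : ∀ a b : ℝ, a ≤ n (a * z + b * w) ∧ b ≤ n (a * z + b * w) := by
    intro a b
    obtain ⟨y, hy, e⟩ := hscale (a * z + b * w)
    set N := n (a * z + b * w)
    have hN : 0 ≤ N := apply_nonneg n _
    have ere := congrArg Complex.re e
    have eim := congrArg Complex.im e
    simp only [Complex.add_re, Complex.add_im, Complex.mul_re, Complex.mul_im, Complex.ofReal_re,
      Complex.ofReal_im, Complex.smul_re, Complex.smul_im, smul_eq_mul, zero_mul, sub_zero,
      add_zero] at ere eim
    constructor
    · refine le_of_mul_le_mul_right ?_ hMpos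
      -- Cramer's rule: a coefficient is a ratio of determinants, and the numerator is at most `N *
      -- M` by maximality.
      calc a * M = N * (y.re * w.im - y.im * w.re) := by
            rw [hM]; linear_combination w.im * ere - w.re * eim
        _ ≤ N * M := mul_le_mul_of_nonneg_left (hle y hy w hw) hN
    · refine le_of_mul_le_mul_right ?_ hMpos
      calc b * M = N * (z.re * y.im - z.im * y.re) := by
            rw [hM]; linear_combination z.re * eim - z.im * ere
        _ ≤ N * M := mul_le_mul_of_nonneg_left (hle z hz y hy) hN
  refine ⟨z, w, hz, hw, fun a b => ?_⟩
  have h1 := hcoef a b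
  have h2 := hcoef (-a) (-b)
  have e : ((-a : ℝ) : ℂ) * z + ((-b : ℝ) : ℂ) * w = -(a * z + b * w) := by push_cast; ring
  rw [e, map_neg_eq_map] at h2
  exact ⟨abs_le'.2 ⟨h1.1, h2.1⟩, abs_le'.2 ⟨h1.2, h2.2⟩⟩

end Auerbach

/-! ### Solving the normalised Hölder bound. -/

section PhaseRetrievalLemmas

/-- Here `δ` stands for `‖|F| - |G|‖`, `s` for `‖F‖ + ‖G‖`, `N` for the lower bound on `‖F - c G‖`,
and `d` for `‖|f| - |g|‖`. The powers of `2` combine to `2^γ 2^(1-γ) = 2`, and with the `√2` lost in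
`N` they give `√8`. -/
theorem le_of_normalized_holder_bound {γ C D d δ s N : ℝ} (hγ0 : 0 < γ) (hγ1 : γ ≤ 1) (hC : 0 < C)
    (hD : 0 < D) (hd : 0 ≤ d) (hδ0 : 0 ≤ δ) (hδ : δ ≤ 2 / D * d) (hs0 : 0 ≤ s) (hs : s ≤ 2)
    (hN : 1 ≤ Real.sqrt 2 * N) (h : N ≤ C * δ ^ γ * s ^ (1 - γ)) :
    D ≤ Real.sqrt 2 * (Real.sqrt 8 * C) ^ (1 / γ) * d := by
  have h8 : Real.sqrt 8 = Real.sqrt 2 * 2 := by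
    rw [show (8 : ℝ) = 2 * 2 ^ 2 by norm_num, Real.sqrt_mul (by norm_num),
      Real.sqrt_sq (by norm_num)]
  have h1 : δ ^ γ * s ^ (1 - γ) ≤ 2 * (d / D) ^ γ := by
    calc δ ^ γ * s ^ (1 - γ) ≤ (2 * (d / D)) ^ γ * 2 ^ (1 - γ) := by
          refine mul_le_mul (Real.rpow_le_rpow hδ0 (hδ.trans_eq (by ring)) hγ0.le)
            (Real.rpow_le_rpow hs0 hs (by linarith)) (by positivity) (by positivity)
      _ = (2 ^ γ * 2 ^ (1 - γ)) * (d / D) ^ γ := by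
          rw [Real.mul_rpow (by norm_num) (by positivity)]; ring
      _ = 2 * (d / D) ^ γ := by
          rw [← Real.rpow_add (by norm_num)]; simp
  have h2 : 1 ≤ Real.sqrt 8 * C * (d / D) ^ γ := by
    calc 1 ≤ Real.sqrt 2 * N := hN
      _ ≤ Real.sqrt 2 * (C * (2 * (d / D) ^ γ)) := by
          refine mul_le_mul_of_nonneg_left ?_ (Real.sqrt_nonneg _)
          rw [mul_assoc] at h
          exact h.trans (mul_le_mul_of_nonneg_left h1 hC.le)
      _ = _ := by rw [h8]; ring
  have h3 : 1 ≤ (Real.sqrt 8 * C) ^ (1 / γ) * (d / D) := by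
    have h4 := Real.one_le_rpow h2 (by positivity : 0 ≤ 1 / γ)
    rwa [Real.mul_rpow (by positivity) (by positivity), ← Real.rpow_mul (by positivity),
      mul_one_div_cancel hγ0.ne', Real.rpow_one] at h4
  have h5 : D ≤ (Real.sqrt 8 * C) ^ (1 / γ) * d := by
    rwa [← mul_div_assoc, le_div_iff₀ hD, one_mul] at h3
  -- The bound already holds without the outer factor `√2`, which is only slack.
  refine h5.trans ?_
  rw [mul_assoc]
  exact le_mul_of_one_le_left (by positivity) (Real.one_le_sqrt.2 (by norm_num))

variable {𝕜 V : Type*} [RCLike 𝕜] [NormedAddCommGroup V] [NormedSpace 𝕜 V]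

theorem iInf_norm_sub_smul_le (f g : V) {c : 𝕜} (hc : ‖c‖ = 1) :
    (⨅ c : {c : 𝕜 // ‖c‖ = 1}, ‖f - (c : 𝕜) • g‖) ≤ ‖f - c • g‖ :=
  ciInf_le (f := fun c : {c : 𝕜 // ‖c‖ = 1} => ‖f - (c : 𝕜) • g‖)
    ⟨0, by rintro _ ⟨c, rfl⟩; exact norm_nonneg _⟩ ⟨c, hc⟩

theorem le_iInf_norm_sub_smul {f g : V} {N : ℝ} (h : ∀ c : 𝕜, ‖c‖ = 1 → N ≤ ‖f - c • g‖) :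
    N ≤ ⨅ c : {c : 𝕜 // ‖c‖ = 1}, ‖f - (c : 𝕜) • g‖ :=
  have : Nonempty {c : 𝕜 // ‖c‖ = 1} := ⟨⟨1, norm_one⟩⟩
  le_ciInf fun c => h c c.2

variable {X : Type*} [NormedAddCommGroup X]

theorem doesStablePhaseRetrieval_of_pos {m : V → X} {E : Submodule 𝕜 V} {K : ℝ} (hK : 0 ≤ K)
    (h : ∀ f ∈ E, ∀ g ∈ E, ∀ D : ℝ, 0 < D → (∀ c : 𝕜, ‖c‖ = 1 → D ≤ ‖f - c • g‖) →
      D ≤ K * ‖m f - m g‖) : DoesStablePhaseRetrieval 𝕜 m E K := by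
  intro f hf g hg
  rcases (Real.iInf_nonneg fun c : {c : 𝕜 // ‖c‖ = 1} => norm_nonneg (f - (c : 𝕜) • g)).eq_or_lt
    with h0 | h0
  · rw [← h0]; positivity
  · exact h f hf g hg _ h0 fun c hc => iInf_norm_sub_smul_le f g hc

end PhaseRetrievalLemmas

/-! ### From Hölder stability to stability, real and complex. -/

section Main

variable {X : Type*} [NormedAddCommGroup X] [NormedSpace ℝ X] [CompleteSpace X] [Lattice X]
  [IsOrderedAddMonoid X] [IsOrderedModule ℝ X] [HasSolidNorm X] {γ C : ℝ}

theorem DoesHolderStablePhaseRetrieval.doesStablePhaseRetrieval_real (hγ0 : 0 < γ) (hγ1 : γ ≤ 1)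
    (hC : 0 < C) {E : Submodule ℝ X}
    (hE : DoesHolderStablePhaseRetrieval ℝ (fun x : X => |x|) E γ C) :
    DoesStablePhaseRetrieval ℝ (fun x : X => |x|) E
      (Real.sqrt 2 * (Real.sqrt 8 * C) ^ (1 / γ)) := by
  refine doesStablePhaseRetrieval_of_pos (by positivity) fun f hf g hg D hD hDle => ?_
  set r := ‖f - g‖ with hr
  set s := ‖f + g‖ with hs
  have hDr : D ≤ r := by simpa using hDle 1 (by simp)
  have hDs : D ≤ s := by simpa using hDle (-1) (by simp)
  have hr0 : 0 < r := hD.trans_le hDr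
  have hs0 : 0 < s := hD.trans_le hDs
  -- These coefficients make `F - G` and `F + G` the normalisations of `f - g` and `f + g`. The only
  -- unimodular scalars are `±1`, so `N = 1` is available.
  set a := (r⁻¹ + s⁻¹) / 2 with ha
  set b := (s⁻¹ - r⁻¹) / 2 with hb
  have hsub : (a • f + b • g) - (b • f + a • g) = r⁻¹ • (f - g) := by
    rw [ha, hb]; module
  have hadd : (a • f + b • g) + (b • f + a • g) = s⁻¹ • (f + g) := by
    rw [ha, hb]; module
  have hnsub : ‖(a • f + b • g) - (b • f + a • g)‖ = 1 := by
    rw [hsub, norm_smul, norm_inv, Real.norm_of_nonneg hr0.le, inv_mul_cancel₀ hr0.ne']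
  have hnadd : ‖(a • f + b • g) + (b • f + a • g)‖ = 1 := by
    rw [hadd, norm_smul, norm_inv, Real.norm_of_nonneg hs0.le, inv_mul_cancel₀ hs0.ne']
  set F := a • f + b • g
  set G := b • f + a • g
  have h1 : ‖F‖ + ‖G‖ ≤ 2 := by
    have e1 : F = (2⁻¹ : ℝ) • ((F + G) + (F - G)) := by module
    have e2 : G = (2⁻¹ : ℝ) • ((F + G) - (F - G)) := by module
    have h1 := norm_add_le (F + G) (F - G)
    have h2 := norm_sub_le (F + G) (F - G)
    have h3 : ‖F‖ = 2⁻¹ * ‖(F + G) + (F - G)‖ := by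
      conv_lhs => rw [e1, norm_smul]
      norm_num
    have h4 : ‖G‖ = 2⁻¹ * ‖(F + G) - (F - G)‖ := by
      conv_lhs => rw [e2, norm_smul]
      norm_num
    linarith
  have hab : |a| + |b| ≤ 2 / D := by
    have h1 : |a| ≤ (r⁻¹ + s⁻¹) / 2 := (abs_of_nonneg (by positivity)).le
    have h2 : |b| ≤ (r⁻¹ + s⁻¹) / 2 := by
      rw [abs_le]
      constructor <;> linarith [inv_pos.2 hr0, inv_pos.2 hs0]
    have h3 : r⁻¹ ≤ D⁻¹ := inv_anti₀ hD hDr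
    have h4 : s⁻¹ ≤ D⁻¹ := inv_anti₀ hD hDs
    rw [div_eq_mul_inv]
    linarith
  refine le_of_normalized_holder_bound hγ0 hγ1 hC hD (norm_nonneg _) (norm_nonneg _)
    ((norm_abs_sub_abs_comb_le f g a b).trans (mul_le_mul_of_nonneg_right hab (norm_nonneg _)))
    (by positivity) h1 (N := 1) ?_ ((le_iInf_norm_sub_smul fun c hc => ?_).trans
      (hE F (E.add_mem (E.smul_mem _ hf) (E.smul_mem _ hg)) G
        (E.add_mem (E.smul_mem _ hf) (E.smul_mem _ hg))))
  · rw [mul_one]; exact Real.one_le_sqrt.2 (by norm_num)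
  · rcases eq_or_eq_neg_of_abs_eq hc with rfl | rfl
    · rw [one_smul, hnsub]
    · rw [neg_one_smul, sub_neg_eq_add, hnadd]

open ComplexConjugate in
/-- The real-linear norm `z ↦ ‖z f - z̄ g‖` on `ℂ`. -/
noncomputable def phaseSeminorm {V : Type*} [NormedAddCommGroup V] [NormedSpace ℂ V] (f g : V) :
    Seminorm ℝ ℂ :=
  Seminorm.of (fun z => ‖z • f - conj z • g‖)
    (fun z w => by
      refine le_trans (le_of_eq ?_) (norm_add_le _ _)
      congr 1
      rw [map_add]; module)
    (fun c z => by
      have e : (c • z) • f - conj (c • z) • g = (c : ℂ) • (z • f - conj z • g) := by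
        rw [Complex.real_smul, map_mul, Complex.conj_ofReal]; module
      rw [e, norm_smul, Complex.norm_real])

open ComplexConjugate in
theorem DoesHolderStablePhaseRetrieval.doesStablePhaseRetrieval_complex (hγ0 : 0 < γ)
    (hγ1 : γ ≤ 1) (hC : 0 < C) {E : Submodule ℂ (Complexification X)}
    (hE : DoesHolderStablePhaseRetrieval ℂ (Complexification.modulus (X := X)) E γ C) :
    DoesStablePhaseRetrieval ℂ (Complexification.modulus (X := X)) E
      (Real.sqrt 2 * (Real.sqrt 8 * C) ^ (1 / γ)) := by
  refine doesStablePhaseRetrieval_of_pos (by positivity) fun f hf g hg D hD hDle => ?_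
  have hn : ∀ z, phaseSeminorm f g z = ‖z • f - conj z • g‖ := fun _ => rfl
  have hcont : Continuous (phaseSeminorm f g) := by
    change Continuous fun z : ℂ => ‖z • f - conj z • g‖
    fun_prop
  have hDn : ∀ z, D * ‖z‖ ≤ phaseSeminorm f g z := by
    intro z
    rcases eq_or_ne z 0 with rfl | hz
    · simp
    · have e : z • f - conj z • g = z • (f - (conj z / z) • g) := by
        -- The quotient `conj z / z` is unimodular, hence the lower bound `D` applies to it.
        rw [smul_sub, smul_smul, mul_div_cancel₀ _ hz]
      rw [hn, e, norm_smul, mul_comm]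
      refine mul_le_mul_of_nonneg_left (hDle _ ?_) (norm_nonneg _)
      rw [norm_div, RCLike.norm_conj, div_self (norm_ne_zero_iff.2 hz)]
  obtain ⟨z, w, hz, hw, hzw⟩ := exists_auerbach_basis (phaseSeminorm f g) hcont hD hDn
  have hnorm : ∀ z, phaseSeminorm f g z ≤ 1 → ‖z‖ ≤ 1 / D := fun z hz => by
    rw [le_div_iff₀ hD, mul_comm]; exact (hDn z).trans hz
  -- Chosen so that `F = (p - i q) / 2` and `G = -(p + i q) / 2`, where `p` and `q` are the vectors
  -- of norm at most one attached to `z` and `w`.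
  set a : ℂ := (z - Complex.I * w) / 2 with ha
  set b : ℂ := -conj (z + Complex.I * w) / 2 with hb
  have h2c : conj (2 : ℂ) = 2 := Complex.conj_ofNat 2
  have hca : conj a = (conj z + Complex.I * conj w) / 2 := by simp [ha, h2c]
  have hb' : b = -(conj z - Complex.I * conj w) / 2 := by simp [hb, sub_eq_add_neg]
  have hcb : conj b = -(z + Complex.I * w) / 2 := by
    rw [hb, map_div₀, map_neg, Complex.conj_conj, h2c]
  have hab : ‖a‖ + ‖b‖ ≤ 2 / D := by
    have h1 : ‖a‖ ≤ (‖z‖ + ‖w‖) / 2 := by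
      rw [ha, norm_div]
      simpa using div_le_div_of_nonneg_right (norm_sub_le z (Complex.I * w)) zero_le_two
    have h2 : ‖b‖ ≤ (‖z‖ + ‖w‖) / 2 := by
      rw [← RCLike.norm_conj b, hcb, norm_div, norm_neg]
      simpa using div_le_div_of_nonneg_right (norm_add_le z (Complex.I * w)) zero_le_two
    have h3 := hnorm z hz
    have h4 := hnorm w hw
    rw [show 2 / D = 1 / D + 1 / D by ring]
    linarith
  rw [hn] at hz hw
  set p := z • f - conj z • g with hp
  set q := w • f - conj w • g with hq
  have hF : a • f + b • g = (2⁻¹ : ℂ) • (p - Complex.I • q) := by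
    rw [hp, hq, ha, hb']; module
  have hG : conj b • f + conj a • g = (-2⁻¹ : ℂ) • (p + Complex.I • q) := by
    rw [hp, hq, hca, hcb]; module
  have h1 : ‖a • f + b • g‖ + ‖conj b • f + conj a • g‖ ≤ 2 := by
    have hI : ‖Complex.I • q‖ = ‖q‖ := by rw [norm_smul, Complex.norm_I, one_mul]
    rw [hF, hG, norm_smul, norm_smul, norm_neg, norm_inv, Complex.norm_two]
    linarith [norm_sub_le p (Complex.I • q), norm_add_le p (Complex.I • q)]
  refine le_of_normalized_holder_bound (N := 1 / Real.sqrt 2) hγ0 hγ1 hC hD (norm_nonneg _)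
    (norm_nonneg _)
    ((Complexification.norm_modulus_sub_modulus_conj_comb_le f g a b).trans
      (mul_le_mul_of_nonneg_right hab (norm_nonneg _)))
    (by positivity) h1 (by rw [mul_one_div_cancel (by positivity)])
    ((le_iInf_norm_sub_smul fun c hc => ?_).trans
      (hE _ (E.add_mem (E.smul_mem _ hf) (E.smul_mem _ hg)) _
        (E.add_mem (E.smul_mem _ hf) (E.smul_mem _ hg))))
  -- A square root of `c` makes the difference symmetric: `F - u² G = u (v f - v̄ g)` with `v = Re u
  -- · z - Im u · w`, so its norm is `n v`.
  obtain ⟨u, rfl⟩ := IsAlgClosed.exists_pow_nat_eq c zero_lt_two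
  have hu : ‖u‖ = 1 := by
    rw [norm_pow] at hc
    exact (pow_eq_one_iff_of_nonneg (norm_nonneg u) two_ne_zero).1 hc
  have hunit : u * conj u = 1 := by rw [Complex.mul_conj', hu]; simp
  have hsq : u.re ^ 2 + u.im ^ 2 = 1 := by
    have := Complex.sq_norm u
    rw [hu, Complex.normSq_apply] at this
    linarith
  have hure : (u.re : ℂ) = (u + conj u) / 2 := Complex.re_eq_add_conj u
  have huim : ((-u.im : ℝ) : ℂ) = Complex.I * (u - conj u) / 2 := by
    push_cast
    rw [Complex.im_eq_sub_conj]
    field_simp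
    rw [Complex.I_sq]; ring
  set v : ℂ := u.re * z + (-u.im : ℝ) * w with hv
  have e1 : a - u ^ 2 * conj b = u * v := by
    rw [hv, hure, huim, ha, hcb]
    linear_combination (-(z - Complex.I * w) / 2) * hunit
  have e2 : b - u ^ 2 * conj a = -(u * conj v) := by
    have hcv : conj v = u.re * conj z + (-u.im : ℝ) * conj w := by
      rw [hv, map_add, map_mul, map_mul, Complex.conj_ofReal, Complex.conj_ofReal]
    rw [hcv, hure, huim, hb', hca]
    linear_combination ((conj z - Complex.I * conj w) / 2) * hunit
  have e : (a • f + b • g) - u ^ 2 • (conj b • f + conj a • g) = u • (v • f - conj v • g) := by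
    calc _ = (a - u ^ 2 * conj b) • f + (b - u ^ 2 * conj a) • g := by module
      _ = _ := by rw [e1, e2]; module
  rw [e, norm_smul, hu, one_mul, ← hn]
  obtain ⟨h2, h3⟩ := hzw u.re (-u.im)
  rw [← hv] at h2 h3
  rw [abs_neg] at h3
  have h4 : 0 ≤ phaseSeminorm f g v := apply_nonneg _ _
  have h5 := sq_le_sq' (by linarith [abs_nonneg u.re]) h2
  have h6 := sq_le_sq' (by linarith [abs_nonneg u.im]) h3
  rw [sq_abs] at h5 h6
  -- The Auerbach property bounds both `|Re u|` and `|Im u|` by `n v`; as their squares sum to `1`,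
  -- `n v ^ 2 ≥ 1 / 2`.
  refine abs_le_of_sq_le_sq' ?_ h4 |>.2
  rw [div_pow, Real.sq_sqrt zero_le_two]
  linarith

end Main

theorem corollary3p12 {X : Type*} [NormedAddCommGroup X] [NormedSpace ℝ X] [CompleteSpace X]
    [Lattice X] [IsOrderedAddMonoid X] [IsOrderedModule ℝ X] [HasSolidNorm X]
    (γ C : ℝ) (hγ0 : 0 < γ) (hγ1 : γ ≤ 1) (hC : 0 < C) :
    (∀ E : Submodule ℝ X,
      DoesHolderStablePhaseRetrieval ℝ (fun x : X => |x|) E γ C →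
        DoesStablePhaseRetrieval ℝ (fun x : X => |x|) E
          (Real.sqrt 2 * (Real.sqrt 8 * C) ^ (1 / γ))) ∧
    (∀ E : Submodule ℂ (Complexification X),
      DoesHolderStablePhaseRetrieval ℂ (Complexification.modulus (X := X)) E γ C →
        DoesStablePhaseRetrieval ℂ (Complexification.modulus (X := X)) E
          (Real.sqrt 2 * (Real.sqrt 8 * C) ^ (1 / γ))) :=
  ⟨fun _ hE => hE.doesStablePhaseRetrieval_real hγ0 hγ1 hC,
    fun _ hE => hE.doesStablePhaseRetrieval_complex hγ0 hγ1 hC⟩
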